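/- Let $\mathbb{G}$ be an H-type group: the connected, simply connected Lie group whose Lie algebra is a two-step stratified Lie algebra $\mathcal{G}=V_1\oplus V_2$ (so $[V_1,V_1]=V_2\neq 0$ and $[V_1,V_2]=[V_2,V_2]=0$), where $V_1,V_2$ are finite-dimensional real inner product spaces, such that the linear map $J:V_2\to\mathrm{End}(V_1)$ defined by $\langle J_z u,v\rangle=\langle z,[u,v]\rangle$ for $u,v\in V_1$, $z\in V_2$, satisfies $J_z^2=-\|z\|^2\,\mathrm{Id}$ for all $z\in V_2$. Let $m=\dim V_1$, $k=\dim V_2$, and $Q=m+2k$. Identify $\mathbb{G}$ with $V_1\oplus V_2$ by the exponential map, writing $x=\exp(v(x)+z(x))$ with $v(x)\in V_1$ and $z(x)\in V_2$, so that $x\cdot y=x+y+\tfrac12[x,y]$; let $dx$ be Lebesgue measure, let $\nabla_{\mathbb{G}}=(X_1,\dots,X_m)$, where $X_1,\dots,X_m$ are the left-invariant vector fields on $\mathbb{G}$ whose values at the origin form an orthonormal basis of $V_1$, and let $$K(x)=\bigl(|v(x)|^4+16|z(x)|^2\bigr)^{1/4}.$$ Let $\alpha\in\mathbb{R}$. Then,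 for every real-valued $\phi\in C_0^\infty(\mathbb{G}\setminus\{0\})$, both integrals below are finite and $$\int_{\mathbb{G}}K^\alpha|\nabla_{\mathbb{G}}\phi|^2\,dx\ \ge\ \Bigl(\frac{Q+\alpha-2}{2}\Bigr)^2\int_{\mathbb{G}}K^\alpha\frac{|v|^2}{K^4}\,\phi^2\,dx .$$ Moreover, the constant is sharp: if $C\in\mathbb{R}$ is such that $\int_{\mathbb{G}}K^\alpha|\nabla_{\mathbb{G}}\phi|^2\,dx\ge C\int_{\mathbb{G}}K^\alpha\frac{|v|^2}{K^4}\phi^2\,dx$ for all real-valued $\phi\in C_0^\infty(\mathbb{G}\setminus\{0\})$, then $C\le\bigl(\frac{Q+\alpha-2}{2}\bigr)^2$. -/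

import Mathlib

open MeasureTheory
open scoped ContDiff InnerProductSpace

noncomputable section

/-- A stratified two-step real Lie algebra `𝒢 = V₁ ⊕ V₂`, with `V₁ = V` and `V₂ = Z` finite
dimensional inner product spaces. As `[V₁, V₂] = [V₂, V₂] = 0`, the Lie bracket of `𝒢` is determined
by its restriction `V₁ × V₁ → V₂`, an alternating bilinear map whose values span `V₂`. -/
structure TwoStepAlgebra (V Z : Type*)
    [NormedAddCommGroup V] [InnerProductSpace ℝ V] [FiniteDimensional ℝ V]
    [NormedAddCommGroup Z] [InnerProductSpace ℝ Z] [FiniteDimensional ℝ Z] where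
  /-- The Lie bracket `[u, v] ∈ V₂` of `u, v ∈ V₁`. -/
  bracket : V →ₗ[ℝ] V →ₗ[ℝ] Z
  bracket_self : ∀ u, bracket u u = 0
  /-- `[V₁, V₁] = V₂`. -/
  span_bracket : Submodule.span ℝ {w : Z | ∃ u v : V, bracket u v = w} = ⊤
  /-- The step is two, i.e. `V₂ ≠ 0`. -/
  exists_ne_zero : ∃ w : Z, w ≠ 0

namespace TwoStepAlgebra

variable {V Z : Type*}
  [NormedAddCommGroup V] [InnerProductSpace ℝ V] [FiniteDimensional ℝ V]
  [NormedAddCommGroup Z] [InnerProductSpace ℝ Z] [FiniteDimensional ℝ Z]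

/-- The Lie bracket on the whole of `𝒢 = V₁ ⊕ V₂`. -/
def lieBracket (𝒢 : TwoStepAlgebra V Z) (x y : V × Z) : V × Z := (0, 𝒢.bracket x.1 y.1)

/-- `𝒢` is a Lie ring. -/
@[reducible] def lieRing (𝒢 : TwoStepAlgebra V Z) : LieRing (V × Z) where
  bracket := 𝒢.lieBracket
  add_lie x y z := by simp [lieBracket]
  lie_add x y z := by simp [lieBracket]
  lie_self x := by simp [lieBracket, 𝒢.bracket_self]
  leibniz_lie x y z := by simp [lieBracket]

/-- `𝒢` is a real Lie algebra. -/
@[reducible] def lieAlgebra (𝒢 : TwoStepAlgebra V Z) : @LieAlgebra ℝ (V × Z) _ 𝒢.lieRing :=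
  letI := 𝒢.lieRing
  { (inferInstance : Module ℝ (V × Z)) with
    lie_smul := fun t x y => by
      change 𝒢.lieBracket x (t • y) = t • 𝒢.lieBracket x y
      simp [lieBracket] }

/-- The law of the connected, simply connected Lie group `G` with Lie algebra `𝒢`, where `G` is
identified with `V₁ ⊕ V₂` by the exponential map: `x = exp (v(x) + z(x))` is the pair
`(v(x), z(x))`, and the Baker-Campbell-Hausdorff formula reads `x · y = x + y + ½ [x, y]`. -/
def mul (𝒢 : TwoStepAlgebra V Z) (x y : V × Z) : V × Z :=
  x + y + (1 / 2 : ℝ) • 𝒢.lieBracket x y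

/-- `G` is a group, with neutral element `0` and inverse `x⁻¹ = -x`. -/
@[reducible] def group (𝒢 : TwoStepAlgebra V Z) : Group (V × Z) where
  mul := 𝒢.mul
  one := 0
  inv x := -x
  mul_assoc x y z := by
    change 𝒢.mul (𝒢.mul x y) z = 𝒢.mul x (𝒢.mul y z)
    ext <;> simp [mul, lieBracket] <;> abel
  one_mul x := by
    change 𝒢.mul 0 x = x
    simp [mul, lieBracket]
  mul_one x := by
    change 𝒢.mul x 0 = x
    simp [mul, lieBracket]
  inv_mul_cancel x := by
    change 𝒢.mul (-x) x = 0
    simp [mul, lieBracket, 𝒢.bracket_self]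

/-- The map `J : V₂ → End V₁`; see `inner_J` for its characteristic property. -/
def J (𝒢 : TwoStepAlgebra V Z) : Z →ₗ[ℝ] Module.End ℝ V :=
  LinearMap.mk₂ ℝ (fun w u => LinearMap.adjoint (𝒢.bracket u) w)
    (by simp) (by simp) (by simp) (by simp)

/-- `J` is the map determined by `⟨J_w u, v⟩ = ⟨w, [u, v]⟩`. -/
theorem inner_J (𝒢 : TwoStepAlgebra V Z) (w : Z) (u v : V) :
    ⟪𝒢.J w u, v⟫_ℝ = ⟪w, 𝒢.bracket u v⟫_ℝ := by
  simp [J, LinearMap.adjoint_inner_left]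

/-- The H-type condition `J_w² = -‖w‖² Id` for all `w ∈ V₂`. -/
def IsHType (𝒢 : TwoStepAlgebra V Z) : Prop :=
  ∀ w : Z, 𝒢.J w * 𝒢.J w = -(‖w‖ ^ 2 • (1 : Module.End ℝ V))

/-- The homogeneous dimension `Q = dim V₁ + 2 dim V₂`. -/
def homogeneousDim (_𝒢 : TwoStepAlgebra V Z) : ℕ :=
  Module.finrank ℝ V + 2 * Module.finrank ℝ Z

/-- The derivative `X f` of `f` along the left invariant vector field `X` on `G` whose value at the
origin is `u ∈ V₁`: `(X f)(x) = d/dt f (x · exp (t u))` at `t = 0`. -/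
def leftDeriv (𝒢 : TwoStepAlgebra V Z) (u : V) (f : V × Z → ℝ) (x : V × Z) : ℝ :=
  deriv (fun t : ℝ => f (𝒢.mul x (t • u, 0))) 0

/-- The horizontal gradient `∇_G f = (X₁ f, …, X_m f)` with respect to an orthonormal basis of
`V₁`. -/
def horizontalGrad (𝒢 : TwoStepAlgebra V Z) {m : ℕ} (X : OrthonormalBasis (Fin m) ℝ V)
    (f : V × Z → ℝ) (x : V × Z) : EuclideanSpace ℝ (Fin m) :=
  WithLp.toLp 2 fun j => 𝒢.leftDeriv (X j) f x

/-- Kaplan's gauge `K(x) = (|v(x)|⁴ + 16 |z(x)|²)^{1/4}`. -/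
def kaplanGauge (_𝒢 : TwoStepAlgebra V Z) (x : V × Z) : ℝ :=
  (‖x.1‖ ^ 4 + 16 * ‖x.2‖ ^ 2) ^ (1 / 4 : ℝ)

/-- The class `C₀^∞(G ∖ {0})` of real valued smooth functions with compact support in
`G ∖ {0}`. -/
def IsTestFunction (_𝒢 : TwoStepAlgebra V Z) (φ : V × Z → ℝ) : Prop :=
  ContDiff ℝ ∞ φ ∧ HasCompactSupport φ ∧ (0 : V × Z) ∉ tsupport φ

/-- The integrand `K^α |∇_G φ|²`. -/
def energyDensity (𝒢 : TwoStepAlgebra V Z) {m : ℕ} (X : OrthonormalBasis (Fin m) ℝ V)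
    (α : ℝ) (φ : V × Z → ℝ) (x : V × Z) : ℝ :=
  𝒢.kaplanGauge x ^ α * ‖𝒢.horizontalGrad X φ x‖ ^ 2

/-- The integrand `K^α (|v|² / K⁴) φ²`. -/
def hardyDensity (𝒢 : TwoStepAlgebra V Z) (α : ℝ) (φ : V × Z → ℝ) (x : V × Z) : ℝ :=
  𝒢.kaplanGauge x ^ α * (‖x.1‖ ^ 2 / 𝒢.kaplanGauge x ^ 4) * φ x ^ 2

end TwoStepAlgebra

end

/-! ### Horizontal calculus of the gauge -/

namespace TwoStepAlgebra

variable {V Z : Type*}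
  [NormedAddCommGroup V] [InnerProductSpace ℝ V] [FiniteDimensional ℝ V]
  [NormedAddCommGroup Z] [InnerProductSpace ℝ Z] [FiniteDimensional ℝ Z]

/-! Work with `N = K ^ 4`, a polynomial. Write ∇ for the horizontal gradient, `c = (Q + α - 2) / 2`,
E and H for the energy and Hardy integrals. The H-type condition gives |∇N|² = 16|v|²N
(`norm_gaugeGrad_sq`) and ΔN = 4(Q + 2)|v|² (`sum_fderiv_inner_gaugeGrad`). Hence div(N^β ∇N) = (16β
+ 4(Q + 2)) N^β |v|² off the origin, and as horizontal fields are divergence free this can be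
integrated against test functions (`integral_gaugePow_rpow_mul`).

Inequality: expand N^(α/4) |∇φ + (c/4)(φ/N)∇N|² ≥ 0 and integrate the cross term by parts with β =
α/4 - 1.

Sharpness: the square vanishes for φ = N^(-c/4) = K^(-c), which is not admissible, so it is cut off
by η(log N). For β = -(Q + 2)/4 the field N^β ∇N is divergence free, so in the variable s = log N
the density N^β |v|² dx integrates derivatives of cutoffs to zero, as Lebesgue measure does; this
replaces polar coordinates. The densities of φ become (4η' - cη)² and η², and stretching η by R
makes the η' contribution negligible. -/

theorem bracket_swap (𝒢 : TwoStepAlgebra V Z) (u v : V) :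
    𝒢.bracket u v = -𝒢.bracket v u := by
  have h := 𝒢.bracket_self (u + v)
  simp only [map_add, LinearMap.add_apply, 𝒢.bracket_self, zero_add, add_zero] at h
  exact eq_neg_of_add_eq_zero_right h

theorem inner_J_self (𝒢 : TwoStepAlgebra V Z) (w : Z) (v : V) : ⟪𝒢.J w v, v⟫_ℝ = 0 := by
  rw [inner_J, 𝒢.bracket_self, inner_zero_right]

/-- The bracket is alternating, so J_w is skew and |J_w v|² = -⟨J_w² v, v⟩. -/
theorem IsHType.norm_J_sq {𝒢 : TwoStepAlgebra V Z} (h : 𝒢.IsHType) (w : Z) (v : V) :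
    ‖𝒢.J w v‖ ^ 2 = ‖w‖ ^ 2 * ‖v‖ ^ 2 := by
  have h1 : 𝒢.J w (𝒢.J w v) = -(‖w‖ ^ 2 • v) := by
    simpa using congrArg (fun T : Module.End ℝ V => T v) (h w)
  rw [← real_inner_self_eq_norm_sq, inner_J, bracket_swap, inner_neg_right, ← inner_J, h1,
    inner_neg_left, neg_neg, real_inner_smul_left, real_inner_self_eq_norm_sq]

/-- The horizontal vector field `x ↦ u + ½ [v(x), u]` generated by `u`. -/
noncomputable def horizontalField (𝒢 : TwoStepAlgebra V Z) (x : V × Z) (u : V) : V × Z :=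
  (u, (1 / 2 : ℝ) • 𝒢.bracket x.1 u)

/-- The group law is affine in its second argument, so t ↦ x · exp(tu) is a straight line. -/
theorem leftDeriv_eq (𝒢 : TwoStepAlgebra V Z) (u : V) {f : V × Z → ℝ} {x : V × Z}
    (hf : DifferentiableAt ℝ f x) :
    𝒢.leftDeriv u f x = fderiv ℝ f x (𝒢.horizontalField x u) := by
  have h : (fun t : ℝ => f (𝒢.mul x (t • u, 0))) =
      fun t : ℝ => f (x + t • 𝒢.horizontalField x u) := by
    funext t
    congr 1
    ext <;> simp [mul, lieBracket, horizontalField, smul_smul, mul_comm]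
  rw [leftDeriv, h]
  exact hf.lineDeriv_eq_fderiv

/-- The fourth power of the gauge. -/
noncomputable def gaugePow (_𝒢 : TwoStepAlgebra V Z) (x : V × Z) : ℝ := ‖x.1‖ ^ 4 + 16 * ‖x.2‖ ^ 2

/-- The horizontal gradient of `gaugePow`, as a vector of `V₁`. -/
noncomputable def gaugeGrad (𝒢 : TwoStepAlgebra V Z) (x : V × Z) : V :=
  (4 * ‖x.1‖ ^ 2) • x.1 + (16 : ℝ) • 𝒢.J x.2 x.1

theorem gaugePow_nonneg (𝒢 : TwoStepAlgebra V Z) (x : V × Z) : 0 ≤ 𝒢.gaugePow x := by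
  unfold gaugePow; positivity

theorem gaugePow_pos (𝒢 : TwoStepAlgebra V Z) {x : V × Z} (hx : x ≠ 0) : 0 < 𝒢.gaugePow x := by
  unfold gaugePow
  by_cases h : x.1 = 0
  · have : x.2 ≠ 0 := fun h2 => hx (Prod.ext h h2)
    have := norm_pos_iff.2 this
    positivity
  · have := norm_pos_iff.2 h
    positivity

theorem gaugePow_zero (𝒢 : TwoStepAlgebra V Z) : 𝒢.gaugePow 0 = 0 := by simp [gaugePow]

theorem kaplanGauge_rpow (𝒢 : TwoStepAlgebra V Z) (x : V × Z) (α : ℝ) :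
    𝒢.kaplanGauge x ^ α = 𝒢.gaugePow x ^ (α / 4) := by
  rw [kaplanGauge, ← Real.rpow_mul (by positivity), gaugePow]
  ring_nf

theorem kaplanGauge_pow_four (𝒢 : TwoStepAlgebra V Z) (x : V × Z) :
    𝒢.kaplanGauge x ^ 4 = 𝒢.gaugePow x := by
  have h := 𝒢.kaplanGauge_rpow x (4 : ℕ)
  rw [Real.rpow_natCast] at h
  simpa using h

theorem contDiff_gaugePow (𝒢 : TwoStepAlgebra V Z) : ContDiff ℝ ∞ 𝒢.gaugePow := by
  have h : 𝒢.gaugePow = fun x : V × Z => (‖x.1‖ ^ 2) ^ 2 + 16 * ‖x.2‖ ^ 2 := by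
    funext x; rw [gaugePow]; ring
  rw [h]
  exact ((contDiff_fst.norm_sq ℝ).pow 2).add (contDiff_const.mul (contDiff_snd.norm_sq ℝ))

theorem fderiv_gaugePow (𝒢 : TwoStepAlgebra V Z) (x : V × Z) (u : V) :
    fderiv ℝ 𝒢.gaugePow x (𝒢.horizontalField x u) = ⟪𝒢.gaugeGrad x, u⟫_ℝ := by
  have h : 𝒢.gaugePow = fun x : V × Z => (‖x.1‖ ^ 2) ^ 2 + 16 * ‖x.2‖ ^ 2 := by
    funext x; rw [gaugePow]; ring
  have hd := ((hasFDerivAt_fst (𝕜 := ℝ) (E := V) (F := Z) (p := x)).norm_sq.pow 2).add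
    ((hasFDerivAt_snd (𝕜 := ℝ) (E := V) (F := Z) (p := x)).norm_sq.const_mul 16)
  rw [h]
  refine (congrArg (fun L : V × Z →L[ℝ] ℝ => L (𝒢.horizontalField x u)) hd.fderiv).trans ?_
  simp only [horizontalField, gaugeGrad, inner_add_left, real_inner_smul_left, inner_J]
  simp
  ring

theorem contDiff_bracket (𝒢 : TwoStepAlgebra V Z) (u : V) :
    ContDiff ℝ ∞ (fun x : V × Z => 𝒢.bracket x.1 u) :=
  (LinearMap.toContinuousLinearMap (𝒢.bracket.flip u)).contDiff.comp contDiff_fst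

theorem contDiff_inner_gaugeGrad (𝒢 : TwoStepAlgebra V Z) (u : V) :
    ContDiff ℝ ∞ (fun x : V × Z => ⟪𝒢.gaugeGrad x, u⟫_ℝ) := by
  simp only [gaugeGrad, inner_add_left, real_inner_smul_left, inner_J]
  exact ((contDiff_const.mul (contDiff_fst.norm_sq ℝ)).mul
    (contDiff_fst.inner ℝ contDiff_const)).add
    (contDiff_const.mul (contDiff_snd.inner ℝ (𝒢.contDiff_bracket u)))

/-- The factor [v, u] is constant along the field of u because [u, u] = 0; only |v|², ⟨v, u⟩ and z
contribute. -/
theorem fderiv_inner_gaugeGrad (𝒢 : TwoStepAlgebra V Z) (x : V × Z) (u : V) :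
    fderiv ℝ (fun x : V × Z => ⟪𝒢.gaugeGrad x, u⟫_ℝ) x (𝒢.horizontalField x u) =
      8 * ⟪x.1, u⟫_ℝ ^ 2 + 4 * ‖x.1‖ ^ 2 * ‖u‖ ^ 2 + 8 * ‖𝒢.bracket x.1 u‖ ^ 2 := by
  simp only [gaugeGrad, inner_add_left, real_inner_smul_left, inner_J]
  have hB : HasFDerivAt (fun x : V × Z => 𝒢.bracket x.1 u)
      ((LinearMap.toContinuousLinearMap (𝒢.bracket.flip u)).comp
        (ContinuousLinearMap.fst ℝ V Z)) x :=
    (LinearMap.toContinuousLinearMap (𝒢.bracket.flip u)).hasFDerivAt.comp x hasFDerivAt_fst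
  have hd := (((hasFDerivAt_fst (𝕜 := ℝ) (E := V) (F := Z) (p := x)).norm_sq.const_mul 4).mul
      ((hasFDerivAt_fst (𝕜 := ℝ) (E := V) (F := Z) (p := x)).inner ℝ (hasFDerivAt_const u x))).add
    (((hasFDerivAt_snd (𝕜 := ℝ) (E := V) (F := Z) (p := x)).inner ℝ hB).const_mul 16)
  refine (congrArg (fun L : V × Z →L[ℝ] ℝ => L (𝒢.horizontalField x u)) hd.fderiv).trans ?_
  simp [horizontalField, real_inner_smul_left, 𝒢.bracket_self]
  ring

/-- The two summands of the gradient are orthogonal, since ⟨J_z v, v⟩ = 0, and |J_z v| = |z||v|. -/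
theorem IsHType.norm_gaugeGrad_sq {𝒢 : TwoStepAlgebra V Z} (h : 𝒢.IsHType) (x : V × Z) :
    ‖𝒢.gaugeGrad x‖ ^ 2 = 16 * ‖x.1‖ ^ 2 * 𝒢.gaugePow x := by
  rw [gaugeGrad, norm_add_sq_real, real_inner_smul_left, real_inner_smul_right,
    real_inner_comm, inner_J_self, norm_smul, norm_smul, mul_pow, mul_pow, h.norm_J_sq, gaugePow]
  simp
  ring

/-- Parseval in V₂, then in V₁: each of the k vectors J_w v, with w in an orthonormal basis of V₂,
has norm |v|. -/
theorem IsHType.sum_norm_bracket_sq {𝒢 : TwoStepAlgebra V Z} (h : 𝒢.IsHType) {m : ℕ}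
    (X : OrthonormalBasis (Fin m) ℝ V) (v : V) :
    ∑ j, ‖𝒢.bracket v (X j)‖ ^ 2 = Module.finrank ℝ Z * ‖v‖ ^ 2 := by
  let W := stdOrthonormalBasis ℝ Z
  have h1 : ∀ j, ‖𝒢.bracket v (X j)‖ ^ 2 = ∑ i, ⟪𝒢.J (W i) v, X j⟫_ℝ ^ 2 := by
    intro j
    rw [← W.sum_sq_norm_inner_right]
    simp [inner_J]
  simp_rw [h1]
  rw [Finset.sum_comm]
  have h2 : ∀ i, ∑ j, ⟪𝒢.J (W i) v, X j⟫_ℝ ^ 2 = ‖v‖ ^ 2 := by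
    intro i
    have := X.sum_sq_norm_inner_left (𝒢.J (W i) v)
    rw [h.norm_J_sq] at this
    simpa using this
  simp [h2]

/-- The horizontal Laplacian of `gaugePow`. -/
theorem IsHType.sum_fderiv_inner_gaugeGrad {𝒢 : TwoStepAlgebra V Z} (h : 𝒢.IsHType) {m : ℕ}
    (X : OrthonormalBasis (Fin m) ℝ V) (x : V × Z) :
    ∑ j, fderiv ℝ (fun x : V × Z => ⟪𝒢.gaugeGrad x, X j⟫_ℝ) x (𝒢.horizontalField x (X j)) =
      4 * ((𝒢.homogeneousDim : ℝ) + 2) * ‖x.1‖ ^ 2 := by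
  have hm : Module.finrank ℝ V = m := by simpa using Module.finrank_eq_card_basis X.toBasis
  have h2 : ∑ j, ⟪x.1, X j⟫_ℝ ^ 2 = ‖x.1‖ ^ 2 := by simpa using X.sum_sq_norm_inner_left x.1
  simp only [fderiv_inner_gaugeGrad, Finset.sum_add_distrib, ← Finset.mul_sum,
    h.sum_norm_bracket_sq, h2, homogeneousDim, hm]
  simp
  ring

theorem gaugeGrad_zero (𝒢 : TwoStepAlgebra V Z) : 𝒢.gaugeGrad 0 = 0 := by simp [gaugeGrad]

theorem sum_inner_gaugeGrad_sq {𝒢 : TwoStepAlgebra V Z} (h : 𝒢.IsHType) {m : ℕ}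
    (X : OrthonormalBasis (Fin m) ℝ V) (x : V × Z) :
    ∑ j, ⟪𝒢.gaugeGrad x, X j⟫_ℝ ^ 2 = 16 * ‖x.1‖ ^ 2 * 𝒢.gaugePow x := by
  rw [← h.norm_gaugeGrad_sq]
  simpa using X.sum_sq_norm_inner_left (𝒢.gaugeGrad x)

theorem contDiffAt_gaugePow_rpow (𝒢 : TwoStepAlgebra V Z) (β : ℝ) {x : V × Z} (hx : x ≠ 0) :
    ContDiffAt ℝ ∞ (fun x => 𝒢.gaugePow x ^ β) x :=
  𝒢.contDiff_gaugePow.contDiffAt.rpow_const_of_ne (𝒢.gaugePow_pos hx).ne'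

theorem continuous_fderiv_horizontalField (𝒢 : TwoStepAlgebra V Z) {ψ : V × Z → ℝ}
    (hψ : ContDiff ℝ 1 ψ) (u : V) :
    Continuous fun x => fderiv ℝ ψ x (𝒢.horizontalField x u) :=
  (hψ.continuous_fderiv one_ne_zero).clm_apply
    (continuous_const.prodMk ((𝒢.contDiff_bracket u).continuous.const_smul _))

theorem energyDensity_eq (𝒢 : TwoStepAlgebra V Z) {m : ℕ} (X : OrthonormalBasis (Fin m) ℝ V)
    (α : ℝ) {φ : V × Z → ℝ} {x : V × Z} (hφ : DifferentiableAt ℝ φ x) :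
    𝒢.energyDensity X α φ x =
      𝒢.gaugePow x ^ (α / 4) * ∑ j, fderiv ℝ φ x (𝒢.horizontalField x (X j)) ^ 2 := by
  simp [energyDensity, kaplanGauge_rpow, EuclideanSpace.norm_sq_eq, horizontalGrad,
    leftDeriv_eq _ _ hφ]

theorem hardyDensity_eq (𝒢 : TwoStepAlgebra V Z) (α : ℝ) (φ : V × Z → ℝ) (x : V × Z) :
    𝒢.hardyDensity α φ x = 𝒢.gaugePow x ^ (α / 4 - 1) * (‖x.1‖ ^ 2 * φ x ^ 2) := by
  rw [hardyDensity, kaplanGauge_rpow, kaplanGauge_pow_four]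
  by_cases hx : x = 0
  · simp [hx]
  · rw [Real.rpow_sub_one (𝒢.gaugePow_pos hx).ne']
    ring

end TwoStepAlgebra

/-! ### Divergence of horizontal fields -/

namespace TwoStepAlgebra

variable {V Z : Type*}
  [NormedAddCommGroup V] [InnerProductSpace ℝ V] [FiniteDimensional ℝ V]
  [MeasurableSpace V] [BorelSpace V]
  [NormedAddCommGroup Z] [InnerProductSpace ℝ Z] [FiniteDimensional ℝ Z]
  [MeasurableSpace Z] [BorelSpace Z]

theorem integral_mul_fderiv_eq_zero {f g : V × Z → ℝ} {d : V × Z} (hf : ContDiff ℝ 1 f)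
    (hfd : ∀ x, fderiv ℝ f x d = 0) (hg : ContDiff ℝ 1 g) (hg' : HasCompactSupport g) :
    Integrable (fun x => f x * fderiv ℝ g x d) ∧ ∫ x, f x * fderiv ℝ g x d = 0 := by
  have : (volume : Measure (V × Z)).IsAddHaarMeasure :=
    inferInstanceAs ((volume : Measure V).prod (volume : Measure Z)).IsAddHaarMeasure
  have hgd : Continuous fun x => fderiv ℝ g x d :=
    (hg.continuous_fderiv one_ne_zero).clm_apply continuous_const
  have h1 : Integrable (fun x => f x * fderiv ℝ g x d) :=
    (hf.continuous.mul hgd).integrable_of_hasCompactSupport (hg'.fderiv_apply ℝ d).mul_left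
  refine ⟨h1, ?_⟩
  rw [integral_mul_fderiv_eq_neg_fderiv_mul_of_integrable (by simp [hfd]) h1
    ((hf.continuous.mul hg.continuous).integrable_of_hasCompactSupport hg'.mul_left)
    (fun x _ => (hf.differentiable one_ne_zero) x) (fun x _ => (hg.differentiable one_ne_zero) x)]
  simp [hfd]

/-- Left invariant horizontal vector fields are divergence free. -/
theorem integral_fderiv_horizontalField (𝒢 : TwoStepAlgebra V Z) {g : V × Z → ℝ}
    (hg : ContDiff ℝ 1 g) (hg' : HasCompactSupport g) (u : V) :
    Integrable (fun x => fderiv ℝ g x (𝒢.horizontalField x u)) ∧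
      ∫ x, fderiv ℝ g x (𝒢.horizontalField x u) = 0 := by
  let W := stdOrthonormalBasis ℝ Z
  have h0 := integral_mul_fderiv_eq_zero (f := fun _ => (1 : ℝ)) (d := ((u, 0) : V × Z))
    contDiff_const (by simp) hg hg'
  -- Split the field into the constant part (u, 0) and central parts along (0, W i); the coefficient
  -- of the latter depends on v only, so it is constant in the direction differentiated.
  have hi : ∀ i, Integrable (fun x : V × Z => ((1 / 2 : ℝ) * ⟪W i, 𝒢.bracket x.1 u⟫_ℝ) *
        fderiv ℝ g x (0, W i)) ∧
      ∫ x : V × Z, ((1 / 2 : ℝ) * ⟪W i, 𝒢.bracket x.1 u⟫_ℝ) * fderiv ℝ g x (0, W i) = 0 := by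
    intro i
    refine integral_mul_fderiv_eq_zero (f := fun x : V × Z =>
      (1 / 2 : ℝ) * ⟪W i, 𝒢.bracket x.1 u⟫_ℝ) ?_ ?_ hg hg'
    · exact (contDiff_const.mul (contDiff_const.inner ℝ (𝒢.contDiff_bracket u))).of_le (by simp)
    · intro x
      have hd : DifferentiableAt ℝ (fun x : V × Z =>
          (1 / 2 : ℝ) * ⟪W i, 𝒢.bracket x.1 u⟫_ℝ) x :=
        ((contDiff_const.mul (contDiff_const.inner ℝ (𝒢.contDiff_bracket u))).differentiable
          (by simp)) x
      rw [← hd.lineDeriv_eq_fderiv]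
      simp [lineDeriv]
  have heq : (fun x => fderiv ℝ g x (𝒢.horizontalField x u)) = fun x =>
      1 * fderiv ℝ g x (u, 0) + ∑ i, ((1 / 2 : ℝ) * ⟪W i, 𝒢.bracket x.1 u⟫_ℝ) *
        fderiv ℝ g x (0, W i) := by
    funext x
    have h2 : 𝒢.horizontalField x u = (u, 0) +
        ∑ i, ((1 / 2 : ℝ) * ⟪W i, 𝒢.bracket x.1 u⟫_ℝ) • ((0, W i) : V × Z) := by
      have := W.sum_repr' (𝒢.bracket x.1 u)
      ext
      · simp [horizontalField, Prod.fst_sum]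
      · conv_lhs => rw [horizontalField, ← this]
        simp [Prod.snd_sum, Finset.smul_sum, smul_smul]
    rw [h2, map_add, map_sum]
    simp only [map_smul, smul_eq_mul, one_mul]
  rw [heq]
  refine ⟨h0.1.add (integrable_finsetSum _ fun i _ => (hi i).1), ?_⟩
  rw [integral_add h0.1 (integrable_finsetSum _ fun i _ => (hi i).1), h0.2,
    integral_finsetSum _ fun i _ => (hi i).1]
  rw [Finset.sum_eq_zero fun i _ => (hi i).2, add_zero]

end TwoStepAlgebra

/-! ### Weighted integration by parts and the Hardy inequality -/

namespace TwoStepAlgebra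

variable {V Z : Type*}
  [NormedAddCommGroup V] [InnerProductSpace ℝ V] [FiniteDimensional ℝ V]
  [MeasurableSpace V] [BorelSpace V]
  [NormedAddCommGroup Z] [InnerProductSpace ℝ Z] [FiniteDimensional ℝ Z]
  [MeasurableSpace Z] [BorelSpace Z]

/-- Continuity is asked on S only, because real powers of N may be singular at the origin. -/
theorem integrable_of_continuousOn_compact {f : V × Z → ℝ} {S : Set (V × Z)} (hS : IsCompact S)
    (hf : ContinuousOn f S) (h0 : ∀ x ∉ S, f x = 0) : Integrable f := by
  have : IsFiniteMeasureOnCompacts (volume : Measure (V × Z)) :=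
    inferInstanceAs (IsFiniteMeasureOnCompacts ((volume : Measure V).prod (volume : Measure Z)))
  have h1 : IntegrableOn f S := hf.integrableOn_compact hS
  exact (integrableOn_iff_integrable_of_support_subset
    (fun x hx => by_contra fun hxS => hx (h0 x hxS))).1 h1

/-- The divergence theorem for the field `ψ N ^ β ∇N`, with `N` the fourth power of the gauge. -/
theorem IsHType.integral_gaugePow_rpow_mul {𝒢 : TwoStepAlgebra V Z} (h : 𝒢.IsHType) {m : ℕ}
    (X : OrthonormalBasis (Fin m) ℝ V) {ψ : V × Z → ℝ} (hψ : ContDiff ℝ 1 ψ)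
    (hc : HasCompactSupport ψ) (h0 : (0 : V × Z) ∉ tsupport ψ) (β : ℝ) :
    Integrable (fun x => 𝒢.gaugePow x ^ β *
        ∑ j, fderiv ℝ ψ x (𝒢.horizontalField x (X j)) * ⟪𝒢.gaugeGrad x, X j⟫_ℝ) ∧
      Integrable (fun x => 𝒢.gaugePow x ^ β * (‖x.1‖ ^ 2 * ψ x)) ∧
      ∫ x, 𝒢.gaugePow x ^ β *
        ∑ j, fderiv ℝ ψ x (𝒢.horizontalField x (X j)) * ⟪𝒢.gaugeGrad x, X j⟫_ℝ =
      -(16 * β + 4 * ((𝒢.homogeneousDim : ℝ) + 2)) *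
        ∫ x, 𝒢.gaugePow x ^ β * (‖x.1‖ ^ 2 * ψ x) := by
  have hne : ∀ x ∈ tsupport ψ, x ≠ 0 := fun x hx hx0 => h0 (hx0 ▸ hx)
  have hz : ∀ x ∉ tsupport ψ, ψ x = 0 := fun x hx => image_eq_zero_of_notMem_tsupport hx
  have hfz : ∀ x ∉ tsupport ψ, fderiv ℝ ψ x = 0 := fun x hx =>
    fderiv_of_notMem_tsupport ℝ hx
  have hNc : ContinuousOn (fun x => 𝒢.gaugePow x ^ β) (tsupport ψ) := fun x hx =>
    (𝒢.contDiffAt_gaugePow_rpow β (hne x hx)).continuousAt.continuousWithinAt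
  have hi1 : Integrable (fun x => 𝒢.gaugePow x ^ β *
      ∑ j, fderiv ℝ ψ x (𝒢.horizontalField x (X j)) * ⟪𝒢.gaugeGrad x, X j⟫_ℝ) := by
    refine integrable_of_continuousOn_compact hc (hNc.mul ?_) fun x hx => by simp [hfz x hx]
    exact (continuous_finsetSum _ fun j _ => (𝒢.continuous_fderiv_horizontalField hψ (X j)).mul
      (𝒢.contDiff_inner_gaugeGrad (X j)).continuous).continuousOn
  have hi2 : Integrable (fun x => 𝒢.gaugePow x ^ β * (‖x.1‖ ^ 2 * ψ x)) := by
    refine integrable_of_continuousOn_compact hc (hNc.mul ?_) fun x hx => by simp [hz x hx]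
    exact ((continuous_fst.norm.pow 2).mul hψ.continuous).continuousOn
  refine ⟨hi1, hi2, ?_⟩
  let g : Fin m → V × Z → ℝ := fun j x =>
    𝒢.gaugePow x ^ β * (ψ x * ⟪𝒢.gaugeGrad x, X j⟫_ℝ)
  have hgz : ∀ j, ∀ x ∉ tsupport ψ, g j x = 0 := fun j x hx => by simp [g, hz x hx]
  have hgc : ∀ j, HasCompactSupport (g j) := fun j => HasCompactSupport.intro hc (hgz j)
  have hgd : ∀ j, ContDiff ℝ 1 (g j) := by
    intro j
    rw [contDiff_iff_contDiffAt]
    intro x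
    by_cases hx : x ∈ tsupport ψ
    · exact ((𝒢.contDiffAt_gaugePow_rpow β (hne x hx)).of_le (by simp)).mul
        (hψ.contDiffAt.mul ((𝒢.contDiff_inner_gaugeGrad (X j)).contDiffAt.of_le (by simp)))
    · refine (contDiffAt_const (c := (0 : ℝ))).congr_of_eventuallyEq ?_
      filter_upwards [(isClosed_tsupport ψ).isOpen_compl.mem_nhds hx] with y hy
      exact hgz j y hy
  -- Product rule: differentiating N^β gives β N^(β-1) |∇N|² = 16β N^β |v|², and ∇N contributes ΔN.
  have hsum : ∀ x, ∑ j, fderiv ℝ (g j) x (𝒢.horizontalField x (X j)) =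
      𝒢.gaugePow x ^ β *
        ∑ j, fderiv ℝ ψ x (𝒢.horizontalField x (X j)) * ⟪𝒢.gaugeGrad x, X j⟫_ℝ +
      (16 * β + 4 * ((𝒢.homogeneousDim : ℝ) + 2)) *
        (𝒢.gaugePow x ^ β * (‖x.1‖ ^ 2 * ψ x)) := by
    intro x
    by_cases hx : x ∈ tsupport ψ
    · have hN := 𝒢.gaugePow_pos (hne x hx)
      have hd : ∀ j, fderiv ℝ (g j) x (𝒢.horizontalField x (X j)) =
          𝒢.gaugePow x ^ β *
            (fderiv ℝ ψ x (𝒢.horizontalField x (X j)) * ⟪𝒢.gaugeGrad x, X j⟫_ℝ) +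
          𝒢.gaugePow x ^ β * ψ x * fderiv ℝ (fun x : V × Z => ⟪𝒢.gaugeGrad x, X j⟫_ℝ) x
            (𝒢.horizontalField x (X j)) +
          β * 𝒢.gaugePow x ^ (β - 1) * ψ x * ⟪𝒢.gaugeGrad x, X j⟫_ℝ ^ 2 := by
        intro j
        have h1 := (𝒢.contDiff_gaugePow.differentiable (by simp) x).hasFDerivAt.rpow_const
          (p := β) (Or.inl hN.ne')
        have h2 := (hψ.differentiable one_ne_zero x).hasFDerivAt
        have h3 := ((𝒢.contDiff_inner_gaugeGrad (X j)).differentiable (by simp) x).hasFDerivAt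
        have h4 := h1.mul (h2.mul h3)
        refine (congrArg (fun L : V × Z →L[ℝ] ℝ => L (𝒢.horizontalField x (X j)))
          h4.fderiv).trans ?_
        simp only [add_apply, smul_apply, smul_eq_mul,
          fderiv_gaugePow, Pi.mul_apply]
        ring
      have hr : 𝒢.gaugePow x ^ β = 𝒢.gaugePow x ^ (β - 1) * 𝒢.gaugePow x := by
        rw [← Real.rpow_add_one hN.ne', sub_add_cancel]
      simp only [hd, Finset.sum_add_distrib, ← Finset.mul_sum, sum_inner_gaugeGrad_sq h,
        h.sum_fderiv_inner_gaugeGrad]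
      rw [hr]
      ring
    · have hd : ∀ j, fderiv ℝ (g j) x = 0 := by
        intro j
        refine (Filter.EventuallyEq.fderiv_eq (f := fun _ => (0 : ℝ)) ?_).trans (by simp)
        filter_upwards [(isClosed_tsupport ψ).isOpen_compl.mem_nhds hx] with y hy
        exact hgz j y hy
      simp [hd, hfz x hx, hz x hx]
  have htot : ∫ x, ∑ j, fderiv ℝ (g j) x (𝒢.horizontalField x (X j)) = 0 := by
    rw [integral_finsetSum _ fun j _ => (𝒢.integral_fderiv_horizontalField (hgd j) (hgc j) _).1]
    exact Finset.sum_eq_zero fun j _ => (𝒢.integral_fderiv_horizontalField (hgd j) (hgc j) _).2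
  simp only [hsum] at htot
  rw [integral_add hi1 (hi2.const_mul _), integral_const_mul] at htot
  linarith

theorem IsHType.hardy {𝒢 : TwoStepAlgebra V Z} (h : 𝒢.IsHType) {m : ℕ}
    (X : OrthonormalBasis (Fin m) ℝ V) (α : ℝ) {φ : V × Z → ℝ} (hφ : 𝒢.IsTestFunction φ) :
    Integrable (𝒢.energyDensity X α φ) volume ∧
      Integrable (𝒢.hardyDensity α φ) volume ∧
      ∫ x, 𝒢.energyDensity X α φ x ≥
        (((𝒢.homogeneousDim : ℝ) + α - 2) / 2) ^ 2 * ∫ x, 𝒢.hardyDensity α φ x := by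
  obtain ⟨hs, hc, h0⟩ := hφ
  have hne : ∀ x ∈ tsupport φ, x ≠ 0 := fun x hx hx0 => h0 (hx0 ▸ hx)
  have hs1 : ContDiff ℝ 1 φ := hs.of_le (by simp)
  have hE : 𝒢.energyDensity X α φ = fun x =>
      𝒢.gaugePow x ^ (α / 4) * ∑ j, fderiv ℝ φ x (𝒢.horizontalField x (X j)) ^ 2 :=
    funext fun x => 𝒢.energyDensity_eq X α (hs1.differentiable one_ne_zero x)
  have hH : 𝒢.hardyDensity α φ = fun x =>
      𝒢.gaugePow x ^ (α / 4 - 1) * (‖x.1‖ ^ 2 * φ x ^ 2) :=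
    funext fun x => 𝒢.hardyDensity_eq α φ x
  have hEi : Integrable (𝒢.energyDensity X α φ) := by
    rw [hE]
    refine integrable_of_continuousOn_compact hc (.mul (fun x hx =>
      (𝒢.contDiffAt_gaugePow_rpow _ (hne x hx)).continuousAt.continuousWithinAt) ?_)
      fun x hx => by simp [fderiv_of_notMem_tsupport ℝ hx]
    exact (continuous_finsetSum _ fun j _ =>
      (𝒢.continuous_fderiv_horizontalField hs1 (X j)).pow 2).continuousOn
  have hsub : tsupport (fun x => φ x ^ 2) ⊆ tsupport φ :=
    closure_mono fun x hx => by
      simp only [Function.mem_support] at hx ⊢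
      exact fun h1 => hx (by simp [h1])
  obtain ⟨hi1, hi2, hint⟩ := h.integral_gaugePow_rpow_mul X (hs1.pow 2)
    (hc.of_isClosed_subset (isClosed_tsupport _) hsub) (fun hx => h0 (hsub hx)) (α / 4 - 1)
  set c := ((𝒢.homogeneousDim : ℝ) + α - 2) / 2 with hcdef
  refine ⟨hEi, hH ▸ hi2, ?_⟩
  -- Off the origin this is the expanded square N^(α/4) |∇φ + (c/4)(φ/N)∇N|². At the origin ∇N and v
  -- vanish and only the energy term is left.
  have hpt : ∀ x, 0 ≤ 𝒢.energyDensity X α φ x + ((c / 4) * (𝒢.gaugePow x ^ (α / 4 - 1) *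
      ∑ j, fderiv ℝ (fun x => φ x ^ 2) x (𝒢.horizontalField x (X j)) * ⟪𝒢.gaugeGrad x, X j⟫_ℝ)
      + c ^ 2 * (𝒢.gaugePow x ^ (α / 4 - 1) * (‖x.1‖ ^ 2 * φ x ^ 2))) := by
    intro x
    rw [hE]
    by_cases hx : x = 0
    · subst hx
      simp only [gaugeGrad_zero, inner_zero_left, mul_zero, Finset.sum_const_zero, Prod.fst_zero,
        norm_zero]
      have := Real.rpow_nonneg (𝒢.gaugePow_nonneg 0) (α / 4)
      have : 0 ≤ ∑ j, fderiv ℝ φ 0 (𝒢.horizontalField 0 (X j)) ^ 2 :=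
        Finset.sum_nonneg fun j _ => sq_nonneg _
      simp only [ne_eq, OfNat.ofNat_ne_zero, not_false_eq_true, zero_pow, zero_mul, mul_zero,
        add_zero]
      positivity
    · have hN := 𝒢.gaugePow_pos hx
      have hd : ∀ j, fderiv ℝ (fun x => φ x ^ 2) x (𝒢.horizontalField x (X j)) =
          2 * φ x * fderiv ℝ φ x (𝒢.horizontalField x (X j)) := by
        intro j
        rw [fderiv_fun_pow _ (hs1.differentiable one_ne_zero x)]
        simp
      have hsq : ∑ j, (fderiv ℝ φ x (𝒢.horizontalField x (X j)) +
          c / 4 * φ x / 𝒢.gaugePow x * ⟪𝒢.gaugeGrad x, X j⟫_ℝ) ^ 2 =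
          ∑ j, fderiv ℝ φ x (𝒢.horizontalField x (X j)) ^ 2 +
          c / 2 * φ x / 𝒢.gaugePow x *
            ∑ j, fderiv ℝ φ x (𝒢.horizontalField x (X j)) * ⟪𝒢.gaugeGrad x, X j⟫_ℝ +
          (c / 4 * φ x / 𝒢.gaugePow x) ^ 2 * (16 * ‖x.1‖ ^ 2 * 𝒢.gaugePow x) := by
        rw [← sum_inner_gaugeGrad_sq h X, Finset.mul_sum, Finset.mul_sum,
          ← Finset.sum_add_distrib, ← Finset.sum_add_distrib]
        exact Finset.sum_congr rfl fun j _ => by ring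
      have hnn : 0 ≤ 𝒢.gaugePow x ^ (α / 4) * ∑ j, (fderiv ℝ φ x (𝒢.horizontalField x (X j)) +
          c / 4 * φ x / 𝒢.gaugePow x * ⟪𝒢.gaugeGrad x, X j⟫_ℝ) ^ 2 :=
        mul_nonneg (Real.rpow_nonneg hN.le _) (Finset.sum_nonneg fun j _ => sq_nonneg _)
      refine hnn.trans_eq ?_
      simp only [hd, mul_assoc, ← Finset.mul_sum]
      rw [hsq, Real.rpow_sub_one hN.ne']
      field_simp
      ring
  have hnn := integral_nonneg (μ := volume) (Pi.le_def.2 hpt)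
  rw [integral_add hEi ((hi1.const_mul _).fun_add (hi2.const_mul _)),
    integral_add (hi1.const_mul _) (hi2.const_mul _), integral_const_mul, integral_const_mul,
    hint] at hnn
  rw [hH]
  -- The cross term thus integrates to -(c/4)(8c)H = -2c²H, so the square gives E - 2c²H + c²H ≥ 0.
  have h8 : 16 * (α / 4 - 1) + 4 * ((𝒢.homogeneousDim : ℝ) + 2) = 8 * c := by rw [hcdef]; ring
  rw [h8] at hnn
  linarith

end TwoStepAlgebra

/-! ### Integrals of functions of the gauge -/

theorem intervalIntegral_const_of_eq_zero {h : ℝ → ℝ} {a b : ℝ} (h0 : ∀ s ∉ Set.Icc a b, h s = 0)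
    (hh : Continuous h) :
    (∀ s ≤ a, ∫ t in a..s, h t = 0) ∧ ∀ s, b ≤ s → ∫ t in a..s, h t = ∫ t in a..b, h t := by
  refine ⟨fun s hs => ?_, fun s hs => ?_⟩
  · rw [intervalIntegral.integral_symm, neg_eq_zero, intervalIntegral.integral_of_le hs,
      integral_Ioc_eq_integral_Ioo]
    exact setIntegral_eq_zero_of_forall_eq_zero fun t ht => h0 t fun h => absurd ht.2 h.1.not_gt
  · rw [← sub_eq_zero, intervalIntegral.integral_interval_sub_left (hh.intervalIntegrable _ _)
      (hh.intervalIntegrable _ _), intervalIntegral.integral_of_le hs]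
    exact setIntegral_eq_zero_of_forall_eq_zero fun t ht => h0 t fun h => absurd ht.1 h.2.not_gt

namespace TwoStepAlgebra

section Radial

variable {V Z : Type*}
  [NormedAddCommGroup V] [InnerProductSpace ℝ V] [FiniteDimensional ℝ V]
  [NormedAddCommGroup Z] [InnerProductSpace ℝ Z] [FiniteDimensional ℝ Z]

theorem isCompact_gaugePow_preimage (𝒢 : TwoStepAlgebra V Z) (a b : ℝ) :
    IsCompact (𝒢.gaugePow ⁻¹' Set.Icc a b) := by
  -- The radius comes from the crude bounds |v| ≤ 1 + |v|⁴ and |z| ≤ 1 + 16|z|².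
  refine (isCompact_closedBall (0 : V × Z) (1 + b)).of_isClosed_subset
    (isClosed_Icc.preimage 𝒢.contDiff_gaugePow.continuous) fun x hx => ?_
  have h := hx.2
  rw [gaugePow] at h
  have h1 := norm_nonneg x.1
  have h2 := norm_nonneg x.2
  rw [mem_closedBall_zero_iff, Prod.norm_def, max_le_iff]
  constructor
  · nlinarith [sq_nonneg (‖x.1‖ ^ 2 - 1), sq_nonneg (‖x.1‖ - 1), sq_nonneg (‖x.2‖)]
  · nlinarith [sq_nonneg (‖x.2‖ - 1), pow_nonneg h1 4]

variable (𝒢 : TwoStepAlgebra V Z) {g : ℝ → ℝ} {a b : ℝ}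

theorem tsupport_comp_gaugePow (h0 : ∀ t ∉ Set.Icc a b, g t = 0) :
    tsupport (fun x => g (𝒢.gaugePow x)) ⊆ 𝒢.gaugePow ⁻¹' Set.Icc a b :=
  closure_minimal (fun _ hx => by_contra fun hxS => hx (h0 _ hxS))
    (isClosed_Icc.preimage 𝒢.contDiff_gaugePow.continuous)

theorem hasCompactSupport_comp_gaugePow (h0 : ∀ t ∉ Set.Icc a b, g t = 0) :
    HasCompactSupport (fun x => g (𝒢.gaugePow x)) :=
  (𝒢.isCompact_gaugePow_preimage a b).of_isClosed_subset (isClosed_tsupport _)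
    (𝒢.tsupport_comp_gaugePow h0)

theorem zero_notMem_tsupport_comp_gaugePow (ha : 0 < a) (h0 : ∀ t ∉ Set.Icc a b, g t = 0) :
    (0 : V × Z) ∉ tsupport (fun x => g (𝒢.gaugePow x)) := fun hx => by
  have := (𝒢.tsupport_comp_gaugePow h0 hx).1
  rw [gaugePow_zero] at this
  linarith

theorem contDiff_comp_gaugePow {n : ℕ∞} (ha : 0 < a) (h0 : ∀ t ∉ Set.Icc a b, g t = 0)
    (hg : ∀ t, 0 < t → ContDiffAt ℝ n g t) : ContDiff ℝ n (fun x => g (𝒢.gaugePow x)) := by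
  rw [contDiff_iff_contDiffAt]
  intro x
  by_cases hx : x = 0
  · have hx' : x ∉ tsupport (fun x => g (𝒢.gaugePow x)) :=
      hx ▸ 𝒢.zero_notMem_tsupport_comp_gaugePow ha h0
    refine (contDiffAt_const (c := (0 : ℝ))).congr_of_eventuallyEq ?_
    filter_upwards [(isClosed_tsupport _).isOpen_compl.mem_nhds hx'] with y hy
    exact image_eq_zero_of_notMem_tsupport (f := fun x => g (𝒢.gaugePow x)) hy
  · exact (hg _ (𝒢.gaugePow_pos hx)).comp x
      (𝒢.contDiff_gaugePow.contDiffAt.of_le (by exact_mod_cast le_top))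

theorem fderiv_comp_gaugePow {g' : ℝ} {x : V × Z} (hg : HasDerivAt g g' (𝒢.gaugePow x)) (u : V) :
    fderiv ℝ (fun x => g (𝒢.gaugePow x)) x (𝒢.horizontalField x u) =
      g' * ⟪𝒢.gaugeGrad x, u⟫_ℝ := by
  rw [← fderiv_gaugePow]
  exact congrArg (fun L : V × Z →L[ℝ] ℝ => L (𝒢.horizontalField x u)) (hg.comp_hasFDerivAt x
    (𝒢.contDiff_gaugePow.differentiable (by simp) x).hasFDerivAt).fderiv

/-- `N ^ (-(Q + 2) / 4) |v|² h (log N)`, with `N` the fourth power of the gauge. -/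
noncomputable def radialDensity (h : ℝ → ℝ) (x : V × Z) : ℝ :=
  𝒢.gaugePow x ^ (-((𝒢.homogeneousDim : ℝ) + 2) / 4) *
    (‖x.1‖ ^ 2 * h (Real.log (𝒢.gaugePow x)))

end Radial

/-- At t = 0 the convention `Real.log 0 = 0` requires h 0 = 0; this is why a is positive. -/
theorem comp_log_eq_zero {h : ℝ → ℝ} {a b : ℝ} (ha : 0 < a) (h0 : ∀ s ∉ Set.Icc a b, h s = 0)
    (t : ℝ) (ht0 : 0 ≤ t) (ht : t ∉ Set.Icc (Real.exp a) (Real.exp b)) : h (Real.log t) = 0 := by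
  rcases ht0.eq_or_lt with rfl | hpos
  · rw [Real.log_zero]
    exact h0 0 fun hs => absurd hs.1 ha.not_ge
  · refine h0 _ fun hs => ht ⟨(Real.le_log_iff_exp_le hpos).1 hs.1,
      (Real.log_le_iff_le_exp hpos).1 hs.2⟩

section Radial

variable {V Z : Type*}
  [NormedAddCommGroup V] [InnerProductSpace ℝ V] [FiniteDimensional ℝ V]
  [MeasurableSpace V] [BorelSpace V]
  [NormedAddCommGroup Z] [InnerProductSpace ℝ Z] [FiniteDimensional ℝ Z]
  [MeasurableSpace Z] [BorelSpace Z]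
  {𝒢 : TwoStepAlgebra V Z} {h : ℝ → ℝ} {a b : ℝ}

theorem integrable_radialDensity (hh : Continuous h) (ha : 0 < a)
    (h0 : ∀ s ∉ Set.Icc a b, h s = 0) : Integrable (𝒢.radialDensity h) := by
  refine integrable_of_continuousOn_compact
    (𝒢.isCompact_gaugePow_preimage (Real.exp a) (Real.exp b)) ?_ fun x hx => by
      rw [radialDensity, comp_log_eq_zero ha h0 _ (𝒢.gaugePow_nonneg x) hx, mul_zero, mul_zero]
  have hpos : ∀ x ∈ 𝒢.gaugePow ⁻¹' Set.Icc (Real.exp a) (Real.exp b), 𝒢.gaugePow x ≠ 0 :=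
    fun x hx => ((Real.exp_pos a).trans_le hx.1).ne'
  have hN := 𝒢.contDiff_gaugePow.continuous.continuousOn
    (s := 𝒢.gaugePow ⁻¹' Set.Icc (Real.exp a) (Real.exp b))
  exact (hN.rpow_const fun x hx => Or.inl (hpos x hx)).mul
    ((continuous_fst.norm.pow 2).continuousOn.mul (hh.comp_continuousOn (hN.log hpos)))

/-- Test the divergence-free field N^β ∇N, β = -(Q + 2)/4, against H(log N): its pairing with the
gradient is 16 N^β |v|² H'(log N). -/
theorem integral_radialDensity_deriv (h𝒢 : 𝒢.IsHType) {H : ℝ → ℝ}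
    (hH : ∀ s, HasDerivAt H (h s) s) (hh : Continuous h) (ha : 0 < a)
    (h0 : ∀ s ∉ Set.Icc a b, H s = 0) : ∫ x, 𝒢.radialDensity h x = 0 := by
  let X := stdOrthonormalBasis ℝ V
  have hH1 : ContDiff ℝ 1 H := by
    rw [contDiff_one_iff_deriv]
    refine ⟨fun s => (hH s).differentiableAt, ?_⟩
    rwa [show deriv H = h from funext fun s => (hH s).deriv]
  -- `Real.log` is even, so without the truncation g could be nonzero at negative t.
  let g : ℝ → ℝ := fun t => H (Real.log (max t 0))
  have hg0 : ∀ t ∉ Set.Icc (Real.exp a) (Real.exp b), g t = 0 := by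
    intro t ht
    refine comp_log_eq_zero ha h0 _ (le_max_right _ _) fun hm => ht ?_
    rcases le_total t 0 with h1 | h1
    · rw [max_eq_right h1] at hm
      exact absurd hm.1 (Real.exp_pos a).not_ge
    · rwa [max_eq_left h1] at hm
  have hgd : ∀ t, 0 < t → g =ᶠ[nhds t] fun t => H (Real.log t) := by
    intro t ht
    filter_upwards [lt_mem_nhds ht] with s hs
    simp [g, max_eq_left hs.le]
  have hg1 : ∀ t, 0 < t → ContDiffAt ℝ (1 : ℕ∞) g t := fun t ht =>
    (hH1.contDiffAt.comp t (Real.contDiffAt_log.2 ht.ne')).congr_of_eventuallyEq (hgd t ht)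
  obtain ⟨-, -, hint⟩ := h𝒢.integral_gaugePow_rpow_mul X
    (𝒢.contDiff_comp_gaugePow (Real.exp_pos a) hg0 hg1)
    (𝒢.hasCompactSupport_comp_gaugePow hg0)
    (𝒢.zero_notMem_tsupport_comp_gaugePow (Real.exp_pos a) hg0)
    (-((𝒢.homogeneousDim : ℝ) + 2) / 4)
  have hz : 16 * (-((𝒢.homogeneousDim : ℝ) + 2) / 4) + 4 * ((𝒢.homogeneousDim : ℝ) + 2) = 0 := by
    ring
  rw [hz, neg_zero, zero_mul] at hint
  have heq : ∀ x, 𝒢.gaugePow x ^ (-((𝒢.homogeneousDim : ℝ) + 2) / 4) *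
      ∑ j, fderiv ℝ (fun x => g (𝒢.gaugePow x)) x (𝒢.horizontalField x (X j)) *
        ⟪𝒢.gaugeGrad x, X j⟫_ℝ = 16 * 𝒢.radialDensity h x := by
    intro x
    by_cases hx : x = 0
    · simp [hx, radialDensity, gaugeGrad_zero]
    · have hN := 𝒢.gaugePow_pos hx
      have hd := ((hH _).comp _ (Real.hasDerivAt_log hN.ne')).congr_of_eventuallyEq (hgd _ hN)
      simp only [𝒢.fderiv_comp_gaugePow hd, mul_assoc, ← sq, ← Finset.mul_sum,
        sum_inner_gaugeGrad_sq h𝒢, radialDensity]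
      field_simp
  simp only [heq, integral_const_mul] at hint
  linarith

/-- With G a primitive of h, h(s/R) - R h(s) is the derivative of R(G(s/R) - G(s)). This has compact
support, since both values of G equal the total integral for large s. -/
theorem integral_radialDensity_div (h𝒢 : 𝒢.IsHType) (hh : Continuous h) (ha : 0 < a)
    (h0 : ∀ s ∉ Set.Icc a b, h s = 0) (hb : 0 ≤ b) {R : ℝ} (hR : 1 ≤ R) :
    ∫ x, 𝒢.radialDensity (fun s => h (s / R)) x = R * ∫ x, 𝒢.radialDensity h x := by
  have hR0 : 0 < R := by linarith
  let G : ℝ → ℝ := fun s => ∫ t in a..s, h t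
  have hG : ∀ s, HasDerivAt G (h s) s := fun s => hh.integral_hasStrictDerivAt a s |>.hasDerivAt
  obtain ⟨hG1, hG2⟩ := intervalIntegral_const_of_eq_zero h0 hh
  have hhR : Continuous fun s => h (s / R) := hh.comp (continuous_id.div_const R)
  have hHd : ∀ s, HasDerivAt (fun s => R * (G (s / R) - G s)) (h (s / R) - R * h s) s := by
    intro s
    have h1 := (((hG (s / R)).comp s ((hasDerivAt_id s).div_const R)).sub (hG s)).const_mul R
    refine h1.congr_deriv ?_
    field_simp
  have hH0 : ∀ s ∉ Set.Icc a (b * R), R * (G (s / R) - G s) = 0 := by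
    intro s hs
    rw [Set.mem_Icc, not_and_or, not_le, not_le] at hs
    rcases hs with hs | hs
    · have h1 : s / R ≤ a := by rw [div_le_iff₀ hR0]; nlinarith
      simp only [G]
      rw [hG1 _ h1, hG1 _ hs.le]; simp
    · have h1 : b ≤ s / R := by rw [le_div_iff₀ hR0]; exact hs.le
      have h2 : b ≤ s := by nlinarith
      simp only [G]
      rw [hG2 _ h1, hG2 _ h2]; simp
  have h1 := integral_radialDensity_deriv h𝒢 hHd (hhR.sub (hh.const_mul R)) ha hH0
  have hi := integrable_radialDensity (𝒢 := 𝒢) hh ha h0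
  have h0R : ∀ s ∉ Set.Icc a (b * R), h (s / R) = 0 := by
    intro s hs
    refine h0 _ fun hm => hs ⟨?_, ?_⟩
    · have := (le_div_iff₀ hR0).1 hm.1
      nlinarith
    · exact (div_le_iff₀ hR0).1 hm.2
  have hiR := integrable_radialDensity (𝒢 := 𝒢) hhR ha h0R
  have heq : 𝒢.radialDensity (fun s => h (s / R) - R * h s) = fun x =>
      𝒢.radialDensity (fun s => h (s / R)) x - R * 𝒢.radialDensity h x := by
    funext x; simp only [radialDensity]; ring
  rw [heq, integral_sub hiR (hi.const_mul R), integral_const_mul] at h1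
  linarith

theorem integral_radialDensity_pos (hh : Continuous h) (ha : 0 < a) (hab : a < b)
    (h0 : ∀ s ∉ Set.Icc a b, h s = 0) (hpos : ∀ s ∈ Set.Ioo a b, 0 < h s) :
    0 < ∫ x, 𝒢.radialDensity h x := by
  have : (volume : Measure (V × Z)).IsOpenPosMeasure :=
    inferInstanceAs ((volume : Measure V).prod (volume : Measure Z)).IsOpenPosMeasure
  have hnn : ∀ s, 0 ≤ h s := by
    have hcl : closure (Set.Ioo a b) ⊆ {s | 0 ≤ h s} :=
      closure_minimal (fun s hs => (hpos s hs).le) (isClosed_le continuous_const hh)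
    intro s
    by_cases hs : s ∈ Set.Icc a b
    · exact hcl (by rwa [closure_Ioo hab.ne])
    · exact (h0 s hs).ge
  have hfn : ∀ x, 0 ≤ 𝒢.radialDensity h x := fun x =>
    mul_nonneg (Real.rpow_nonneg (𝒢.gaugePow_nonneg x) _) (mul_nonneg (sq_nonneg _) (hnn _))
  rw [integral_pos_iff_support_of_nonneg hfn (integrable_radialDensity hh ha h0)]
  let U : Set (V × Z) := {x | x.1 ≠ 0} ∩ 𝒢.gaugePow ⁻¹' Set.Ioo (Real.exp a) (Real.exp b)
  have hUo : IsOpen U := (isOpen_ne_fun continuous_fst continuous_const).inter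
    (isOpen_Ioo.preimage 𝒢.contDiff_gaugePow.continuous)
  have hUs : U ⊆ Function.support (𝒢.radialDensity h) := by
    rintro x ⟨hx1, hx2⟩
    have hN : 0 < 𝒢.gaugePow x := (Real.exp_pos a).trans hx2.1
    have h1 : 0 < h (Real.log (𝒢.gaugePow x)) :=
      hpos _ ⟨(Real.lt_log_iff_exp_lt hN).2 hx2.1, (Real.log_lt_iff_lt_exp hN).2 hx2.2⟩
    have h2 := norm_pos_iff.2 hx1
    exact (mul_pos (Real.rpow_pos_of_pos hN _) (mul_pos (pow_pos h2 2) h1)).ne'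
  -- Otherwise all brackets vanish and could not span V₂ ≠ 0.
  have hne : ∃ v : V, v ≠ 0 := by
    by_contra! hv
    obtain ⟨w, hw⟩ := 𝒢.exists_ne_zero
    have hs : {w : Z | ∃ u v : V, 𝒢.bracket u v = w} ⊆ {0} := by
      rintro w ⟨u, v, rfl⟩
      simp [hv u]
    have := Submodule.span_mono (R := ℝ) hs
    rw [𝒢.span_bracket, Submodule.span_zero_singleton] at this
    exact hw ((Submodule.mem_bot ℝ).1 (this (Submodule.mem_top (x := w))))
  have hUn : U.Nonempty := by
    -- Rescale v to norm e^((a+b)/8), so that log N at (v, 0) is the midpoint of (a, b).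
    obtain ⟨v, hv⟩ := hne
    have hv' := norm_pos_iff.2 hv
    have hn : ‖(Real.exp ((a + b) / 8) / ‖v‖) • v‖ = Real.exp ((a + b) / 8) := by
      rw [norm_smul, norm_div, norm_norm, Real.norm_eq_abs, Real.abs_exp]
      field_simp
    refine ⟨((Real.exp ((a + b) / 8) / ‖v‖) • v, 0), ?_, ?_⟩
    · exact norm_pos_iff.1 (hn.symm ▸ Real.exp_pos ((a + b) / 8))
    · have h4 : 𝒢.gaugePow ((Real.exp ((a + b) / 8) / ‖v‖) • v, 0) = Real.exp ((a + b) / 2) := by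
        rw [gaugePow, hn, ← Real.exp_nat_mul]
        simp
        ring
      rw [Set.mem_preimage, h4]
      exact ⟨Real.exp_lt_exp.2 (by linarith), Real.exp_lt_exp.2 (by linarith)⟩
  exact (hUo.measure_pos volume hUn).trans_le (measure_mono hUs)

end Radial

end TwoStepAlgebra

/-! ### Sharpness of the constant -/

namespace TwoStepAlgebra

variable {V Z : Type*}
  [NormedAddCommGroup V] [InnerProductSpace ℝ V] [FiniteDimensional ℝ V]
  [NormedAddCommGroup Z] [InnerProductSpace ℝ Z] [FiniteDimensional ℝ Z]
  {𝒢 : TwoStepAlgebra V Z}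

/-- The test function `K ^ (-c) η (log N)`, `N = K ^ 4`, together with its two densities. -/
theorem IsHType.exists_radial_testFunction (h𝒢 : 𝒢.IsHType) {m : ℕ}
    (X : OrthonormalBasis (Fin m) ℝ V) {α c : ℝ}
    (hc : c = ((𝒢.homogeneousDim : ℝ) + α - 2) / 2) {η : ℝ → ℝ} (hη : ContDiff ℝ ∞ η) {a b : ℝ}
    (ha : 0 < a) (h0 : ∀ s ∉ Set.Icc a b, η s = 0) :
    ∃ φ : V × Z → ℝ, 𝒢.IsTestFunction φ ∧
      𝒢.energyDensity X α φ = 𝒢.radialDensity (fun s => (4 * deriv η s - c * η s) ^ 2) ∧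
      𝒢.hardyDensity α φ = 𝒢.radialDensity (fun s => η s ^ 2) := by
  let g : ℝ → ℝ := fun t => max t 0 ^ (-c / 4) * η (Real.log (max t 0))
  have hg0 : ∀ t ∉ Set.Icc (Real.exp a) (Real.exp b), g t = 0 := by
    intro t ht
    refine mul_eq_zero_of_right _ (comp_log_eq_zero ha h0 _ (le_max_right _ _) fun hm => ht ?_)
    rcases le_total t 0 with h1 | h1
    · rw [max_eq_right h1] at hm
      exact absurd hm.1 (Real.exp_pos a).not_ge
    · rwa [max_eq_left h1] at hm
  have hgd : ∀ t, 0 < t → g =ᶠ[nhds t] fun t => t ^ (-c / 4) * η (Real.log t) := by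
    intro t ht
    filter_upwards [lt_mem_nhds ht] with s hs
    simp [g, max_eq_left hs.le]
  have hgs : ∀ t, 0 < t → ContDiffAt ℝ (⊤ : ℕ∞) g t := fun t ht =>
    ((contDiffAt_id.rpow_const_of_ne ht.ne').mul
      (hη.contDiffAt.comp t (Real.contDiffAt_log.2 ht.ne'))).congr_of_eventuallyEq (hgd t ht)
  have hφ : ContDiff ℝ ∞ fun x => g (𝒢.gaugePow x) :=
    𝒢.contDiff_comp_gaugePow (Real.exp_pos a) hg0 hgs
  have hgN : ∀ x, g (𝒢.gaugePow x) =
      𝒢.gaugePow x ^ (-c / 4) * η (Real.log (𝒢.gaugePow x)) := fun x => by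
    simp [g, max_eq_left (𝒢.gaugePow_nonneg x)]
  refine ⟨fun x => g (𝒢.gaugePow x), ⟨hφ, 𝒢.hasCompactSupport_comp_gaugePow hg0,
    𝒢.zero_notMem_tsupport_comp_gaugePow (Real.exp_pos a) hg0⟩, ?_, ?_⟩
  · funext x
    rw [𝒢.energyDensity_eq X α (hφ.differentiable (by simp) x), radialDensity]
    by_cases hx : x = 0
    · have hz : fderiv ℝ (fun x => g (𝒢.gaugePow x)) x = 0 :=
        fderiv_of_notMem_tsupport ℝ
          (hx ▸ 𝒢.zero_notMem_tsupport_comp_gaugePow (Real.exp_pos a) hg0)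
      rw [hz]
      simp [hx]
    · have hN := 𝒢.gaugePow_pos hx
      -- Here ∇φ = N^(-c/4-1) (η' - (c/4)η) ∇N; the 16 in |∇N|² turns the bracket into 4η' - cη.
      have hd := ((Real.hasDerivAt_rpow_const (p := -c / 4) (Or.inl hN.ne')).mul
        ((hη.differentiable (by simp) (Real.log (𝒢.gaugePow x))).hasDerivAt.comp _
          (Real.hasDerivAt_log hN.ne'))).congr_of_eventuallyEq (hgd _ hN)
      simp only [𝒢.fderiv_comp_gaugePow hd, mul_pow, ← Finset.mul_sum,
        sum_inner_gaugeGrad_sq h𝒢]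
      have h1 : 𝒢.gaugePow x ^ (-c / 4 - 1) = 𝒢.gaugePow x ^ (-c / 4) / 𝒢.gaugePow x :=
        Real.rpow_sub_one hN.ne' _
      -- Exponents: α/4 - c/2 - 1 = -(Q + 2)/4, as 2c = Q + α - 2.
      have h2 : 𝒢.gaugePow x ^ (-((𝒢.homogeneousDim : ℝ) + 2) / 4) =
          𝒢.gaugePow x ^ (α / 4) * (𝒢.gaugePow x ^ (-c / 4)) ^ 2 / 𝒢.gaugePow x := by
        rw [← Real.rpow_natCast, ← Real.rpow_mul hN.le, ← Real.rpow_add hN,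
          ← Real.rpow_sub_one hN.ne']
        congr 1
        rw [hc]; push_cast; ring
      rw [h1, h2]
      simp only [Function.comp]
      field_simp
      ring
  · funext x
    rw [hardyDensity_eq, hgN, radialDensity]
    by_cases hx : x = 0
    · simp [hx]
    · have hN := 𝒢.gaugePow_pos hx
      have h2 : 𝒢.gaugePow x ^ (-((𝒢.homogeneousDim : ℝ) + 2) / 4) =
          𝒢.gaugePow x ^ (α / 4 - 1) * (𝒢.gaugePow x ^ (-c / 4)) ^ 2 := by
        rw [← Real.rpow_natCast, ← Real.rpow_mul hN.le, ← Real.rpow_add hN]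
        congr 1
        rw [hc]; push_cast; ring
      rw [h2]
      ring

theorem IsHType.hardy_constant_le
    [MeasurableSpace V] [BorelSpace V] [MeasurableSpace Z] [BorelSpace Z] (h𝒢 : 𝒢.IsHType) {m : ℕ}
    (X : OrthonormalBasis (Fin m) ℝ V) (α C : ℝ)
    (hC : ∀ φ : V × Z → ℝ, 𝒢.IsTestFunction φ →
      ∫ x, 𝒢.energyDensity X α φ x ≥ C * ∫ x, 𝒢.hardyDensity α φ x) :
    C ≤ (((𝒢.homogeneousDim : ℝ) + α - 2) / 2) ^ 2 := by
  set c := ((𝒢.homogeneousDim : ℝ) + α - 2) / 2 with hc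
  let η : ContDiffBump (2 : ℝ) := ⟨1 / 2, 1, by norm_num, by norm_num⟩
  have hη : ContDiff ℝ ∞ η := η.contDiff
  have hη0 : ∀ s ∉ Set.Icc (1 : ℝ) 3, η s = 0 := by
    intro s hs
    refine η.zero_of_le_dist ?_
    rw [Real.dist_eq]
    change (1 : ℝ) ≤ |s - 2|
    rw [le_abs]
    rw [Set.mem_Icc, not_and_or, not_le, not_le] at hs
    rcases hs with hs | hs
    · right; linarith
    · left; linarith
  have hη'0 : ∀ s ∉ Set.Icc (1 : ℝ) 3, deriv η s = 0 := by
    intro s hs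
    have hev : η =ᶠ[nhds s] fun _ => (0 : ℝ) := by
      filter_upwards [isClosed_Icc.isOpen_compl.mem_nhds hs] with t ht
      exact hη0 t ht
    rw [hev.deriv_eq]
    simp
  have hη'c : Continuous (deriv η) := hη.continuous_deriv (by simp)
  set I₀ := ∫ x, 𝒢.radialDensity (fun s => η s ^ 2) x with hI₀
  set I₁ := ∫ x, 𝒢.radialDensity (fun s => deriv η s ^ 2) x
  have hI₀pos : 0 < I₀ := by
    refine integral_radialDensity_pos (a := 1) (b := 3) (hη.continuous.pow 2) one_pos (by norm_num)
      (fun s hs => by simp [hη0 s hs]) fun s hs => ?_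
    refine pow_pos (η.pos_of_mem_ball ?_) 2
    rw [Metric.mem_ball, Real.dist_eq]
    change |s - 2| < 1
    rw [abs_lt]
    constructor <;> linarith [hs.1, hs.2]
  -- For the cutoff η(s/R), H = R I₀ and E = 16 I₁/R + c² R I₀. The cross term of (4η' - cη)² is a
  -- multiple of the derivative of the squared cutoff, hence integrates to zero.
  have key : ∀ R : ℝ, 1 ≤ R → (C - c ^ 2) * I₀ * R ^ 2 ≤ 16 * I₁ := by
    intro R hR
    have hR0 : 0 < R := by linarith
    have hout : ∀ s ∉ Set.Icc (1 : ℝ) (3 * R), s / R ∉ Set.Icc (1 : ℝ) 3 := by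
      intro s hs hm
      refine hs ⟨?_, (div_le_iff₀ hR0).1 hm.2⟩
      have := (le_div_iff₀ hR0).1 hm.1
      linarith
    have hηR : ContDiff ℝ ∞ fun s => η (s / R) := hη.comp (contDiff_id.div_const R)
    have hderiv : ∀ s, HasDerivAt (fun s => η (s / R)) (deriv η (s / R) / R) s := by
      intro s
      have := (hη.differentiable (by simp) (s / R)).hasDerivAt.comp s
        ((hasDerivAt_id s).div_const R)
      simpa [Function.comp_def, div_eq_mul_inv] using this
    obtain ⟨φ, hφ, hE, hH⟩ := h𝒢.exists_radial_testFunction X hc hηR one_pos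
      fun s hs => hη0 _ (hout s hs)
    have hle := hC φ hφ
    have hs₀ := integral_radialDensity_div h𝒢 (h := fun s => η s ^ 2) (hη.continuous.pow 2) one_pos
      (fun s hs => by simp [hη0 s hs]) (by norm_num : (0 : ℝ) ≤ 3) hR
    have hs₁ := integral_radialDensity_div h𝒢 (h := fun s => deriv η s ^ 2) (hη'c.pow 2) one_pos
      (fun s hs => by simp [hη'0 s hs]) (by norm_num : (0 : ℝ) ≤ 3) hR
    have hcr := integral_radialDensity_deriv h𝒢 (b := 3 * R) (fun s => (hderiv s).pow 2)
      (by
        have h1 := hη'c.comp (continuous_id.div_const R)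
        have h2 := hη.continuous.comp (continuous_id.div_const R)
        simp only [Function.comp_def, id] at h1 h2
        fun_prop)
      one_pos fun s hs => by simp [hη0 _ (hout s hs)]
    have hi₀ : Integrable (𝒢.radialDensity fun s => η (s / R) ^ 2) :=
      integrable_radialDensity (b := 3 * R) (hηR.continuous.pow 2) one_pos
        fun s hs => by simp [hη0 _ (hout s hs)]
    have hη'R : Continuous fun s => deriv η (s / R) := hη'c.comp (continuous_id.div_const R)
    have hi₁ : Integrable (𝒢.radialDensity fun s => deriv η (s / R) ^ 2) :=
      integrable_radialDensity (b := 3 * R) (hη'R.pow 2) one_pos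
        fun s hs => by simp [hη'0 _ (hout s hs)]
    have hi₂ : Integrable (𝒢.radialDensity fun s =>
        ((2 : ℕ) : ℝ) * η (s / R) ^ (2 - 1) * (deriv η (s / R) / R)) :=
      integrable_radialDensity (b := 3 * R) ((continuous_const.mul (hηR.continuous.pow _)).mul
        (hη'R.div_const R)) one_pos fun s hs => by simp [hη0 _ (hout s hs)]
    have hsplit : 𝒢.energyDensity X α φ = fun x =>
        16 / R ^ 2 * 𝒢.radialDensity (fun s => deriv η (s / R) ^ 2) x +
        (c ^ 2 * 𝒢.radialDensity (fun s => η (s / R) ^ 2) x + -(4 * c) * 𝒢.radialDensity (fun s =>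
          ((2 : ℕ) : ℝ) * η (s / R) ^ (2 - 1) * (deriv η (s / R) / R)) x) := by
      rw [hE]
      funext x
      simp only [radialDensity, fun s => (hderiv s).deriv]
      field_simp
      push_cast
      ring
    rw [hsplit, hH] at hle
    beta_reduce at hle
    rw [integral_add (hi₁.const_mul _) ((hi₀.const_mul _).fun_add (hi₂.const_mul _)),
      integral_add (hi₀.const_mul _) (hi₂.const_mul _), integral_const_mul, integral_const_mul,
      integral_const_mul, hcr, hs₀, hs₁] at hle
    have h1 : 16 / R ^ 2 * (R * I₁) * R = 16 * I₁ := by field_simp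
    nlinarith [mul_le_mul_of_nonneg_right hle hR0.le]
  by_contra! hlt
  have hδ : 0 < (C - c ^ 2) * I₀ := mul_pos (by linarith) hI₀pos
  have h1 := key (max 1 (16 * I₁ / ((C - c ^ 2) * I₀) + 1)) (le_max_left _ _)
  set R := max 1 (16 * I₁ / ((C - c ^ 2) * I₀) + 1)
  have h2 : 1 ≤ R := le_max_left _ _
  have h3 : 16 * I₁ / ((C - c ^ 2) * I₀) + 1 ≤ R := le_max_right _ _
  have h4 : 16 * I₁ < (C - c ^ 2) * I₀ * R := by
    have : 16 * I₁ / ((C - c ^ 2) * I₀) < R := by linarith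
    rw [div_lt_iff₀ hδ] at this
    linarith
  nlinarith [mul_le_mul_of_nonneg_left (show R ≤ R ^ 2 by nlinarith) hδ.le]

end TwoStepAlgebra

theorem theorem3p2 {V Z : Type*}
    [NormedAddCommGroup V] [InnerProductSpace ℝ V] [FiniteDimensional ℝ V]
    [MeasurableSpace V] [BorelSpace V]
    [NormedAddCommGroup Z] [InnerProductSpace ℝ Z] [FiniteDimensional ℝ Z]
    [MeasurableSpace Z] [BorelSpace Z]
    (𝒢 : TwoStepAlgebra V Z) (h𝒢 : 𝒢.IsHType)
    {m : ℕ} (X : OrthonormalBasis (Fin m) ℝ V) (α : ℝ) :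
    (∀ φ : V × Z → ℝ, 𝒢.IsTestFunction φ →
      Integrable (𝒢.energyDensity X α φ) volume ∧
      Integrable (𝒢.hardyDensity α φ) volume ∧
      ∫ x, 𝒢.energyDensity X α φ x ≥
        (((𝒢.homogeneousDim : ℝ) + α - 2) / 2) ^ 2 * ∫ x, 𝒢.hardyDensity α φ x) ∧
    (∀ C : ℝ,
      (∀ φ : V × Z → ℝ, 𝒢.IsTestFunction φ →
        ∫ x, 𝒢.energyDensity X α φ x ≥ C * ∫ x, 𝒢.hardyDensity α φ x) →
      C ≤ (((𝒢.homogeneousDim : ℝ) + α - 2) / 2) ^ 2) := by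
  exact ⟨fun φ hφ => h𝒢.hardy X α hφ, fun C hC => h𝒢.hardy_constant_le X α C hC⟩
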